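/- Let $n\ge 1$. Given $\alpha_0,\dots,\alpha_{n-2}$ in the open unit disc $\mathbb D\subset\mathbb C$ and $\alpha_{n-1}\in S^1$, put $\rho_k=\sqrt{1-|\alpha_k|^2}$, $\Xi_k=\begin{bmatrix}\bar\alpha_k&\rho_k\\ \rho_k&-\alpha_k\end{bmatrix}$ for $0\le k\le n-2$, $\Xi_{-1}=[1]$, $\Xi_{n-1}=[\bar\alpha_{n-1}]$, and let the CMV matrix with these Verblunsky coefficients be the $n\times n$ matrix $\mathcal C=\mathcal L\mathcal M$ with $\mathcal L=\operatorname{diag}(\Xi_0,\Xi_2,\Xi_4,\dots)$ and $\mathcal M=\operatorname{diag}(\Xi_{-1},\Xi_1,\Xi_3,\dots)$. Let $\mathfrak g$ be the algebra of complex $n\times n$ matrices, regarded as a real vector space, $\mathfrak a\subset\mathfrak g$ the anti-Hermitian matrices and $\mathfrak l\subset\mathfrak g$ the lower triangular matrices with real diagonal, so that $\mathfrak g=\mathfrak l\oplus\mathfrak a$ with projections $\pi_{\mathfrak l},\pi_{\mathfrak a}$; let $R=\pi_{\mathfrak l}-\pi_{\mathfrak a}$ and $\langle X,Y\rangle=\operatorname{Im}\operatorname{tr}(XY)$.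 For a real function $\phi$ on an open subset of $\mathfrak g$ define $\nabla\phi$ by $\frac{d}{dt}\big|_{t=0}\phi(B+tC)=\langle\nabla\phi|_B,C\rangle$. The Gelfand–Dikij bracket is $$\{\phi,\psi\}\big|_B=\tfrac12\langle R(XB),YB\rangle-\tfrac12\langle R(BX),BY\rangle,\qquad X=\nabla\phi|_B,\ Y=\nabla\psi|_B,$$ extended bilinearly over $\mathbb C$ to complex-valued functions. Fix $\alpha_{n-1}\in S^1$ and let $\mathcal N$ be the manifold of CMV matrices with this last coefficient (equivalently, with determinant $(-1)^{n-1}\bar\alpha_{n-1}$), with coordinates $(\alpha_0,\dots,\alpha_{n-2})\in\mathbb D^{n-1}$. Every smooth function $f:\mathcal N\to\mathbb C$ extends to a smooth function on an open neighbourhood of $\mathcal N$ in $\mathfrak g$, and for smooth $f,g$ on $\mathcal N$ the restriction to $\mathcal N$ of the Gelfand–Dikij bracket of extensions of $f$ and $g$ does not depend on the extensions; denote it $\{f,g\}$. Then for all $0\le k,l\le n-2$, $$\{\alpha_k,\alpha_l\}=0\qquad\text{and}\qquad\{\alpha_k,\bar\alpha_l\}=-2i\,\delta_{kl}\,\rho_k^2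 .$$ Moreover the Gelfand–Dikij bracket on $\mathcal N$ agrees with the Ablowitz–Ladik bracket: for all smooth $f,g:\mathcal N\to\mathbb C$, with $\alpha_j=u_j+iv_j$, $$\{f,g\}=\sum_{j=0}^{n-2}\rho_j^2\left[\frac{\partial f}{\partial u_j}\frac{\partial g}{\partial v_j}-\frac{\partial f}{\partial v_j}\frac{\partial g}{\partial u_j}\right].$$ -/

import Mathlib

open Matrix

attribute [local instance] Matrix.normedAddCommGroup Matrix.normedSpace

noncomputable section

namespace CMV

/-! ### CMV matrices -/

/-- `ρ = √(1 - |α|²)`. -/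
def rho (z : ℂ) : ℝ := Real.sqrt (1 - ‖z‖ ^ 2)

/-- The `2 × 2` block `Ξ` attached to a coefficient. -/
def Xi (z : ℂ) : Matrix (Fin 2) (Fin 2) ℂ :=
  !![star z, (rho z : ℂ); (rho z : ℂ), -z]

/-- The polydisc `𝔻^m` in which `(α_0, …, α_{m-1})` varies. -/
def polydisc (m : ℕ) : Set (Fin m → ℂ) := {α | ∀ k, ‖α k‖ < 1}

/-- The full list of Verblunsky coefficients: `α_0, …, α_{m-1}` followed by `α_m = a`.
(Only the indices `0, …, m` are ever used.) -/
def coeff {m : ℕ} (a : ℂ) (α : Fin m → ℂ) (k : ℕ) : ℂ :=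
  if h : k < m then α ⟨k, h⟩ else a

/-- `𝓛 = diag(Ξ_0, Ξ_2, Ξ_4, …)` of size `n = m + 1`. If `n` is odd, the last block is cut down
to its upper left entry `[ᾱ_{n-1}]`. -/
def matL {m : ℕ} (a : ℂ) (α : Fin m → ℂ) : Matrix (Fin (m + 1)) (Fin (m + 1)) ℂ :=
  Matrix.of fun i j =>
    if (i : ℕ) / 2 = (j : ℕ) / 2 then
      Xi (coeff a α (2 * ((i : ℕ) / 2))) (Fin.ofNat 2 i) (Fin.ofNat 2 j)
    else 0

/-- `𝓜 = diag([1], Ξ_1, Ξ_3, …)` of size `n = m + 1`. If `n` is even, the last block is cut down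
to its upper left entry `[ᾱ_{n-1}]`. -/
def matM {m : ℕ} (a : ℂ) (α : Fin m → ℂ) : Matrix (Fin (m + 1)) (Fin (m + 1)) ℂ :=
  Matrix.of fun i j =>
    if (i : ℕ) = 0 ∨ (j : ℕ) = 0 then (if i = j then 1 else 0)
    else if ((i : ℕ) - 1) / 2 = ((j : ℕ) - 1) / 2 then
      Xi (coeff a α (2 * (((i : ℕ) - 1) / 2) + 1)) (Fin.ofNat 2 ((i : ℕ) - 1))
        (Fin.ofNat 2 ((j : ℕ) - 1))
    else 0

/-- The `(m+1) × (m+1)` CMV matrix `𝓒 = 𝓛𝓜` with Verblunsky coefficients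
`α_0, …, α_{m-1}` and `α_m = a`. -/
def cmv {m : ℕ} (a : ℂ) (α : Fin m → ℂ) : Matrix (Fin (m + 1)) (Fin (m + 1)) ℂ :=
  matL a α * matM a α

/-! ### The Gelfand–Dikij bracket on `𝔤 = M_n(ℂ)` -/

/-- `𝔞`: the anti-Hermitian matrices, as a real subspace. -/
def skewPart (n : ℕ) : Submodule ℝ (Matrix (Fin n) (Fin n) ℂ) where
  carrier := {A | Aᴴ = -A}
  add_mem' := by
    intro A B hA hB
    simp only [Set.mem_ofPred_eq] at *
    rw [conjTranspose_add, hA, hB, neg_add]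
  zero_mem' := by simp
  smul_mem' := by
    intro c A hA
    simp only [Set.mem_ofPred_eq] at *
    rw [conjTranspose_smul, hA, smul_neg, star_trivial]

/-- `𝔩`: the lower triangular matrices with real diagonal, as a real subspace. -/
def lowerPart (n : ℕ) : Submodule ℝ (Matrix (Fin n) (Fin n) ℂ) where
  carrier := {L | (∀ i j, i < j → L i j = 0) ∧ ∀ i, (L i i).im = 0}
  add_mem' := by
    rintro A B ⟨hA, hA'⟩ ⟨hB, hB'⟩
    exact ⟨fun i j h => by simp [hA i j h, hB i j h], fun i => by simp [hA' i, hB' i]⟩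
  zero_mem' := by simp
  smul_mem' := by
    rintro c A ⟨hA, hA'⟩
    exact ⟨fun i j h => by simp [hA i j h], fun i => by simp [hA' i]⟩

/-- The projection onto `𝔞` along `𝔩`. -/
def projA {n : ℕ} (X : Matrix (Fin n) (Fin n) ℂ) : Matrix (Fin n) (Fin n) ℂ :=
  Matrix.of fun i j =>
    if i < j then X i j
    else if i = j then Complex.I * ((X i i).im : ℂ)
    else -star (X j i)

/-- The projection onto `𝔩` along `𝔞`. -/
def projL {n : ℕ} (X : Matrix (Fin n) (Fin n) ℂ) : Matrix (Fin n) (Fin n) ℂ := X - projA X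

theorem projA_mem {n : ℕ} (X : Matrix (Fin n) (Fin n) ℂ) : projA X ∈ skewPart n := by
  change (projA X)ᴴ = -projA X
  ext i j
  simp only [conjTranspose_apply, projA, Matrix.of_apply, Matrix.neg_apply]
  rcases lt_trichotomy i j with h | h | h
  · simp [h, h.not_gt, h.ne']
  · subst h; simp
  · simp [h, h.not_gt, h.ne']

theorem projL_mem {n : ℕ} (X : Matrix (Fin n) (Fin n) ℂ) : projL X ∈ lowerPart n := by
  refine ⟨fun i j h => ?_, fun i => ?_⟩
  · simp [projL, projA, h]
  · simp [projL, projA]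

theorem isCompl_lowerPart_skewPart (n : ℕ) : IsCompl (lowerPart n) (skewPart n) := by
  constructor
  · rw [Submodule.disjoint_def]
    rintro X ⟨h1, h2⟩ (h3 : Xᴴ = -X)
    have h4 : ∀ i j, star (X j i) = -X i j := fun i j => by
      simpa using congrFun (congrFun h3 i) j
    ext i j
    rcases lt_trichotomy i j with h | h | h
    · exact h1 i j h
    · subst h
      have := congrArg Complex.re (h4 i i)
      apply Complex.ext
      · simp at this ⊢; linarith
      · simpa using h2 i
    · have := h4 i j
      rw [h1 j i h] at this
      simpa using this.symm
  · rw [codisjoint_iff, eq_top_iff]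
    intro X _
    have hX : X = projL X + projA X := by simp [projL]
    rw [hX]
    exact Submodule.add_mem_sup (projL_mem X) (projA_mem X)

/-- `R = π_𝔩 - π_𝔞`. -/
def opR {n : ℕ} (X : Matrix (Fin n) (Fin n) ℂ) : Matrix (Fin n) (Fin n) ℂ := projL X - projA X

/-- The pairing `⟨X, Y⟩ = Im tr (XY)`. -/
def pairing {n : ℕ} (X Y : Matrix (Fin n) (Fin n) ℂ) : ℝ := (X * Y).trace.im

/-- The gradient of `φ : 𝔤 → ℝ` with respect to the pairing:
`[∇φ]_{kl} = ∂φ/∂v_{lk} + i ∂φ/∂u_{lk}`, where `u + iv` are the matrix entries. -/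
def grad {n : ℕ} (φ : Matrix (Fin n) (Fin n) ℂ → ℝ) (B : Matrix (Fin n) (Fin n) ℂ) :
    Matrix (Fin n) (Fin n) ℂ :=
  Matrix.of fun k l =>
    ((fderiv ℝ φ B (Matrix.single l k Complex.I) : ℝ) : ℂ) +
      Complex.I * ((fderiv ℝ φ B (Matrix.single l k 1) : ℝ) : ℂ)

/-- The defining property of the gradient: `dφ|_B (C) = ⟨∇φ|_B, C⟩`. -/
theorem pairing_grad {n : ℕ} (φ : Matrix (Fin n) (Fin n) ℂ → ℝ)
    (B C : Matrix (Fin n) (Fin n) ℂ) : pairing (grad φ B) C = fderiv ℝ φ B C := by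
  have hC : C = ∑ i, ∑ j, ((C i j).re • Matrix.single i j (1 : ℂ) +
      (C i j).im • Matrix.single i j Complex.I) := by
    conv_lhs => rw [matrix_eq_sum_single C]
    refine Finset.sum_congr rfl fun i _ => Finset.sum_congr rfl fun j _ => ?_
    rw [Matrix.smul_single, Matrix.smul_single, ← Matrix.single_add]
    congr 1
    apply Complex.ext <;> simp
  conv_rhs => rw [hC]
  simp only [map_sum, map_add, map_smul, pairing, grad, Matrix.trace, Matrix.diag_apply,
    Matrix.mul_apply, Complex.im_sum, Matrix.of_apply]
  rw [Finset.sum_comm]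
  refine Finset.sum_congr rfl fun i _ => Finset.sum_congr rfl fun j _ => ?_
  simp
  ring

/-- The Gelfand–Dikij bracket of real functions on `𝔤`:
`{φ,ψ}|_B = ½⟨R(XB), YB⟩ - ½⟨R(BX), BY⟩` with `X = ∇φ`, `Y = ∇ψ`. -/
def gdBracketReal {n : ℕ} (φ ψ : Matrix (Fin n) (Fin n) ℂ → ℝ)
    (B : Matrix (Fin n) (Fin n) ℂ) : ℝ :=
  1 / 2 * pairing (opR (grad φ B * B)) (grad ψ B * B) -
    1 / 2 * pairing (opR (B * grad φ B)) (B * grad ψ B)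

/-- The extension of the Gelfand–Dikij bracket to complex functions, bilinear over `ℂ`. -/
def gdBracket {n : ℕ} (F G : Matrix (Fin n) (Fin n) ℂ → ℂ)
    (B : Matrix (Fin n) (Fin n) ℂ) : ℂ :=
  ((gdBracketReal (fun M => (F M).re) (fun M => (G M).re) B : ℝ) : ℂ)
    - ((gdBracketReal (fun M => (F M).im) (fun M => (G M).im) B : ℝ) : ℂ)
    + Complex.I * (((gdBracketReal (fun M => (F M).re) (fun M => (G M).im) B : ℝ) : ℂ)
      + ((gdBracketReal (fun M => (F M).im) (fun M => (G M).re) B : ℝ) : ℂ))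

/-! ### The bracket induced on the CMV matrices with fixed `α_{n-1}` (fixed determinant) -/

/-- `F` is a smooth function on a neighbourhood, in `𝔤`, of the manifold of CMV matrices with
`α_m = a`, and on that manifold it is the function `f` of the coordinates `α_0, …, α_{m-1}`. -/
def IsSmoothExtension {m : ℕ} (a : ℂ) (f : (Fin m → ℂ) → ℂ)
    (F : Matrix (Fin (m + 1)) (Fin (m + 1)) ℂ → ℂ) : Prop :=
  (∃ U : Set (Matrix (Fin (m + 1)) (Fin (m + 1)) ℂ), IsOpen U ∧
    (∀ α ∈ polydisc m, cmv a α ∈ U) ∧ ContDiffOn ℝ (⊤ : ℕ∞) F U) ∧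
  ∀ α ∈ polydisc m, F (cmv a α) = f α

/-- The Gelfand–Dikij bracket of the functions `f` and `g` on the manifold of CMV matrices with
`α_m = a` is the function `h`: both have smooth extensions to a neighbourhood in `𝔤`, and the
Gelfand–Dikij bracket of any two such extensions restricts to `h`. -/
def HasGDBracket {m : ℕ} (a : ℂ) (f g h : (Fin m → ℂ) → ℂ) : Prop :=
  (∃ F, IsSmoothExtension a f F) ∧ (∃ G, IsSmoothExtension a g G) ∧
  ∀ F G, IsSmoothExtension a f F → IsSmoothExtension a g G →
    ∀ α ∈ polydisc m, gdBracket F G (cmv a α) = h α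

/-! ### The Ablowitz–Ladik bracket -/

/-- `∂f/∂u_j`, where `α_j = u_j + i v_j`. -/
def partialU {m : ℕ} (f : (Fin m → ℂ) → ℂ) (j : Fin m) (α : Fin m → ℂ) : ℂ :=
  fderiv ℝ f α (Pi.single j 1)

/-- `∂f/∂v_j`, where `α_j = u_j + i v_j`. -/
def partialV {m : ℕ} (f : (Fin m → ℂ) → ℂ) (j : Fin m) (α : Fin m → ℂ) : ℂ :=
  fderiv ℝ f α (Pi.single j Complex.I)

/-- The Ablowitz–Ladik bracket
`∑_j ρ_j² [∂f/∂u_j ∂g/∂v_j - ∂f/∂v_j ∂g/∂u_j]`. -/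
def alBracket {m : ℕ} (f g : (Fin m → ℂ) → ℂ) (α : Fin m → ℂ) : ℂ :=
  ∑ j, ((rho (α j) ^ 2 : ℝ) : ℂ) *
    (partialU f j α * partialV g j α - partialV f j α * partialU g j α)

end CMV

end

/-!
With `X = ∇φ|_B`, the bracket `{φ, ψ}|_B` is `dψ|_B` applied to the vector
`V_X(B) = π_𝔞(BX) B - B π_𝔞(XB)`, which obeys the Leibniz rule
`V_X(BC) = V_{CX}(B) C + B V_{XB}(C)`, as on a Poisson–Lie group. Hence a product of Poisson maps
from the polydisc that depend on disjoint sets of coordinates is again a Poisson map, and `𝓛` and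
`𝓜` can be treated separately. For a block diagonal unitary `B` the vector `V_X(B)` is block
diagonal and is computed block by block, so everything reduces to the map `Ξ` from the disc to the
`2 × 2` matrices: `V_X(Ξ(z))` is the image under `dΞ` of the Hamiltonian vector, for the bracket
`ρ² (∂f/∂u ∂g/∂v - ∂f/∂v ∂g/∂u)` on the disc, of the pullback of `⟨X, ·⟩`.

Smooth functions of the coefficients extend because the coefficients are recovered successively from
the entries of the matrix: one entry is `ᾱ_0`, and for each `k ≥ 1` another one is `ρ_{k-1} ᾱ_k`.
-/

noncomputable section

namespace CMV

open Matrix Set Function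

section BlockDiagonal

/-- `B` is block diagonal along the fibres of the labelling `b` of its indices. -/
def IsBlockDiag {ι κ R : Type*} [Zero R] (b : ι → κ) (B : Matrix ι ι R) : Prop :=
  ∀ ⦃i j⦄, b i ≠ b j → B i j = 0

namespace IsBlockDiag

variable {ι κ R : Type*} {b : ι → κ}

theorem one [DecidableEq ι] [Zero R] [One R] : IsBlockDiag b (1 : Matrix ι ι R) :=
  fun _ _ hij => one_apply_ne fun h => hij (congrArg b h)

theorem conjTranspose [AddMonoid R] [StarAddMonoid R] {B : Matrix ι ι R} (hB : IsBlockDiag b B) :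
    IsBlockDiag b Bᴴ :=
  fun i j hij => by rw [conjTranspose_apply, hB hij.symm, star_zero]

variable [Fintype ι] [NonUnitalNonAssocSemiring R] {A B Y Z : Matrix ι ι R}

theorem mul (hA : IsBlockDiag b A) (hB : IsBlockDiag b B) : IsBlockDiag b (A * B) := by
  intro i j hij
  rw [mul_apply]
  refine Finset.sum_eq_zero fun l _ => ?_
  by_cases hil : b i = b l
  · rw [hB (hil ▸ hij), mul_zero]
  · rw [hA hil, zero_mul]

theorem mul_apply_congr_left (hB : IsBlockDiag b B) {i j : ι}
    (h : ∀ l, b l = b j → Y i l = Z i l) : (Y * B) i j = (Z * B) i j := by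
  rw [mul_apply, mul_apply]
  refine Finset.sum_congr rfl fun l _ => ?_
  by_cases hl : b l = b j
  · rw [h l hl]
  · rw [hB hl, mul_zero, mul_zero]

theorem mul_apply_congr_right (hB : IsBlockDiag b B) {i j : ι}
    (h : ∀ l, b i = b l → Y l j = Z l j) : (B * Y) i j = (B * Z) i j := by
  rw [mul_apply, mul_apply]
  refine Finset.sum_congr rfl fun l _ => ?_
  by_cases hl : b i = b l
  · rw [h l hl]
  · rw [hB hl, zero_mul, zero_mul]

theorem mul_apply_eq_single {κ' : Type*} {c : ι → κ'} (hA : IsBlockDiag b A)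
    (hB : IsBlockDiag c B) {i j : ι} (l : ι) (hl : ∀ l', b i = b l' → c l' = c j → l' = l) :
    (A * B) i j = A i l * B l j := by
  rw [mul_apply]
  refine Fintype.sum_eq_single l fun l' hne => ?_
  by_cases hil : b i = b l'
  · rw [hB fun hlj => hne (hl l' hil hlj), mul_zero]
  · rw [hA hil, zero_mul]

variable {μ : Type*} [Fintype μ] {e : μ → ι}

theorem submatrix_mul_left (hB : IsBlockDiag b B) (he : Injective e)
    (hsat : ∀ s j, b j = b (e s) → j ∈ range e) (Y : Matrix ι ι R) :
    (B * Y).submatrix e e = B.submatrix e e * Y.submatrix e e := by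
  ext s t
  simp only [submatrix_apply, mul_apply]
  refine (Fintype.sum_of_injective e he _ _ (fun l hl => ?_) fun _ => rfl).symm
  rw [hB fun h => hl (hsat s l h.symm), zero_mul]

theorem submatrix_mul_right (hB : IsBlockDiag b B) (he : Injective e)
    (hsat : ∀ s j, b j = b (e s) → j ∈ range e) (Y : Matrix ι ι R) :
    (Y * B).submatrix e e = Y.submatrix e e * B.submatrix e e := by
  ext s t
  simp only [submatrix_apply, mul_apply]
  refine (Fintype.sum_of_injective e he _ _ (fun l hl => ?_) fun _ => rfl).symm
  rw [hB fun h => hl (hsat t l h), mul_zero]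

end IsBlockDiag

end BlockDiagonal

section Pairing

variable {n : ℕ}

theorem pairing_comm (X Y : Matrix (Fin n) (Fin n) ℂ) : pairing X Y = pairing Y X := by
  rw [pairing, pairing, trace_mul_comm]

theorem pairing_zero_right (X : Matrix (Fin n) (Fin n) ℂ) : pairing X 0 = 0 := by
  simp [pairing]

theorem pairing_add_right (X Y Z : Matrix (Fin n) (Fin n) ℂ) :
    pairing X (Y + Z) = pairing X Y + pairing X Z := by
  simp [pairing, mul_add]

theorem pairing_sub_left (X Y Z : Matrix (Fin n) (Fin n) ℂ) :
    pairing (X - Y) Z = pairing X Z - pairing Y Z := by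
  simp [pairing, sub_mul]

theorem pairing_mul_right (X Y Z : Matrix (Fin n) (Fin n) ℂ) :
    pairing X (Y * Z) = pairing (X * Y) Z := by
  rw [pairing, pairing, mul_assoc]

theorem pairing_mul_left (X Y Z : Matrix (Fin n) (Fin n) ℂ) :
    pairing X (Y * Z) = pairing (Z * X) Y := by
  rw [pairing, pairing, ← mul_assoc, trace_mul_comm, ← mul_assoc]

theorem pairing_eq_pairing_submatrix {d : ℕ} {e : Fin d → Fin n} (he : Injective e)
    (X : Matrix (Fin n) (Fin n) ℂ) {Y : Matrix (Fin n) (Fin n) ℂ}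
    (hY : ∀ i j, ¬(i ∈ range e ∧ j ∈ range e) → Y i j = 0) :
    pairing X Y = pairing (X.submatrix e e) (Y.submatrix e e) := by
  simp only [pairing, trace, Matrix.diag_apply, mul_apply]
  congr 1
  refine (Fintype.sum_of_injective e he _ _ (fun i hi => ?_) fun s => ?_).symm
  · exact Finset.sum_eq_zero fun l _ => by rw [hY l i fun h => hi h.2, mul_zero]
  · refine Fintype.sum_of_injective e he _ _ (fun l hl => ?_) fun _ => rfl
    rw [hY l _ fun h => hl h.1, mul_zero]

end Pairing

section HamiltonianVector

variable {n : ℕ}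

theorem projA_apply_of_lt (X : Matrix (Fin n) (Fin n) ℂ) {i j : Fin n} (hij : i < j) :
    projA X i j = X i j := by
  simp [projA, hij]

theorem projA_apply_of_gt (X : Matrix (Fin n) (Fin n) ℂ) {i j : Fin n} (hij : j < i) :
    projA X i j = (-Xᴴ) i j := by
  simp [projA, hij.not_gt, hij.ne']

theorem projA_submatrix {d : ℕ} {e : Fin d → Fin n} (he : StrictMono e)
    (X : Matrix (Fin n) (Fin n) ℂ) : (projA X).submatrix e e = projA (X.submatrix e e) := by
  ext i j
  simp [projA, he.lt_iff_lt, he.injective.eq_iff]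

/-- The value at `B` of the Hamiltonian vector field, for the Gelfand–Dikij bracket, of a function
whose gradient at `B` is `X`. -/
def hamVec (X B : Matrix (Fin n) (Fin n) ℂ) : Matrix (Fin n) (Fin n) ℂ :=
  projA (B * X) * B - B * projA (X * B)

theorem gdBracketReal_eq_fderiv_hamVec (φ ψ : Matrix (Fin n) (Fin n) ℂ → ℝ)
    (B : Matrix (Fin n) (Fin n) ℂ) :
    gdBracketReal φ ψ B = fderiv ℝ ψ B (hamVec (grad φ B) B) := by
  set X := grad φ B
  set Y := grad ψ B with hY
  have hopR : ∀ Z : Matrix (Fin n) (Fin n) ℂ, opR Z = Z - projA Z - projA Z := fun _ => rfl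
  have hcancel : pairing (X * B) (Y * B) = pairing (B * X) (B * Y) := by
    rw [pairing_mul_left, pairing_mul_right, mul_assoc]
  have hleft : pairing (projA (X * B)) (Y * B) = pairing Y (B * projA (X * B)) := by
    rw [pairing_mul_left, pairing_comm]
  have hright : pairing (projA (B * X)) (B * Y) = pairing Y (projA (B * X) * B) := by
    rw [pairing_mul_right, pairing_comm]
  rw [← pairing_grad, ← hY, pairing_comm Y, hamVec, pairing_sub_left, ← pairing_comm Y,
    ← pairing_comm Y, ← hleft, ← hright, gdBracketReal, hopR, hopR]
  simp only [pairing_sub_left]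
  linear_combination (1 / 2 : ℝ) * hcancel

theorem hamVec_mul (X B C : Matrix (Fin n) (Fin n) ℂ) :
    hamVec X (B * C) = hamVec (C * X) B * C + B * hamVec (X * B) C := by
  simp only [hamVec, mul_assoc, sub_mul, mul_sub]
  abel

variable {κ : Type*} {b : Fin n → κ} {B : Matrix (Fin n) (Fin n) ℂ}

/-- Above the blocks `projA Y` is `Y`, and below them it is `-Yᴴ`. -/
theorem isBlockDiag_hamVec [LinearOrder κ] (hb : Monotone b) (hB : IsBlockDiag b B)
    (hU : B ∈ unitaryGroup (Fin n) ℂ) (X : Matrix (Fin n) (Fin n) ℂ) :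
    IsBlockDiag b (hamVec X B) := by
  intro i j hij
  rw [hamVec, Matrix.sub_apply, sub_eq_zero]
  rcases hij.lt_or_gt with h | h
  · calc (projA (B * X) * B) i j
        = (B * X * B) i j :=
          hB.mul_apply_congr_left fun l hl => projA_apply_of_lt _ (hb.reflect_lt (hl ▸ h))
      _ = (B * (X * B)) i j := by rw [mul_assoc]
      _ = (B * projA (X * B)) i j :=
          hB.mul_apply_congr_right fun l hl => (projA_apply_of_lt _ (hb.reflect_lt (hl ▸ h))).symm
  · have hBB : Bᴴ * B = 1 := Unitary.star_mul_self_of_mem hU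
    have hBB' : B * Bᴴ = 1 := Unitary.mul_star_self_of_mem hU
    calc (projA (B * X) * B) i j
        = (-(B * X)ᴴ * B) i j :=
          hB.mul_apply_congr_left fun l hl => projA_apply_of_gt _ (hb.reflect_lt (hl ▸ h))
      _ = (B * -(X * B)ᴴ) i j := by
          rw [conjTranspose_mul, conjTranspose_mul, mul_neg, neg_mul, mul_assoc, hBB,
            ← mul_assoc B, hBB', mul_one, one_mul]
      _ = (B * projA (X * B)) i j :=
          hB.mul_apply_congr_right fun l hl => (projA_apply_of_gt _ (hb.reflect_lt (hl ▸ h))).symm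

theorem hamVec_submatrix (hB : IsBlockDiag b B) {d : ℕ} {e : Fin d → Fin n} (he : StrictMono e)
    (hsat : ∀ s j, b j = b (e s) → j ∈ range e) (X : Matrix (Fin n) (Fin n) ℂ) :
    (hamVec X B).submatrix e e = hamVec (X.submatrix e e) (B.submatrix e e) := by
  simp only [hamVec, submatrix_sub, Pi.sub_apply, hB.submatrix_mul_left he.injective hsat,
    hB.submatrix_mul_right he.injective hsat, projA_submatrix he]

theorem hamVec_fin_one (X B : Matrix (Fin 1) (Fin 1) ℂ) : hamVec X B = 0 := by
  ext i j
  fin_cases i; fin_cases j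
  simp [hamVec, projA, mul_apply]
  ring

theorem hamVec_apply_self_of_singleton_block (hB : IsBlockDiag b B) {i : Fin n}
    (hi : ∀ j, b j = b i → j = i) (X : Matrix (Fin n) (Fin n) ℂ) : hamVec X B i i = 0 := by
  have hsub := hamVec_submatrix hB (e := fun _ : Fin 1 => i) (Subsingleton.strictMono _)
    (fun _ j hj => ⟨0, (hi j hj).symm⟩) X
  rw [hamVec_fin_one] at hsub
  exact congrFun₂ hsub 0 0

end HamiltonianVector

section Calculus

theorem fderiv_matrix_apply {E : Type*} [NormedAddCommGroup E] [NormedSpace ℝ E] {ι κ : Type*}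
    [Finite ι] [Finite κ] {P : E → Matrix ι κ ℂ} {x : E} (hP : DifferentiableAt ℝ P x) (w : E)
    (i : ι) (j : κ) : fderiv ℝ P x w i j = fderiv ℝ (fun y => P y i j) x w := by
  cases nonempty_fintype ι
  cases nonempty_fintype κ
  have hrow := hasFDerivAt_pi'.1 hP.hasFDerivAt i
  exact (congrArg (· w) (hasFDerivAt_pi'.1 hrow j).fderiv).symm

theorem fderiv_matrix_mul {E : Type*} [NormedAddCommGroup E] [NormedSpace ℝ E] {ι : Type*}
    [Fintype ι] {P Q : E → Matrix ι ι ℂ} {x : E} (hP : DifferentiableAt ℝ P x)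
    (hQ : DifferentiableAt ℝ Q x) (w : E) :
    fderiv ℝ (fun y => P y * Q y) x w = P x * fderiv ℝ Q x w + fderiv ℝ P x w * Q x :=
  congrArg (· w) ((mulLinearMap ℝ).toContinuousBilinearMap.fderiv_of_bilinear hP hQ)

theorem differentiableAt_matrix_mul {E : Type*} [NormedAddCommGroup E] [NormedSpace ℝ E] {ι : Type*}
    [Fintype ι] {P Q : E → Matrix ι ι ℂ} {x : E} (hP : DifferentiableAt ℝ P x)
    (hQ : DifferentiableAt ℝ Q x) : DifferentiableAt ℝ (fun y => P y * Q y) x :=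
  ((LinearMap.mul ℝ (Matrix ι ι ℂ)).toContinuousBilinearMap.hasFDerivAt_of_bilinear
    hP.hasFDerivAt hQ.hasFDerivAt).differentiableAt

theorem fderiv_eq_zero_of_dependsOn {ι F : Type*} [Finite ι] [NormedAddCommGroup F]
    [NormedSpace ℝ F] {P : (ι → ℂ) → F} {s : Set ι} (hP : DependsOn P s) {α w : ι → ℂ}
    (hw : ∀ k ∈ s, w k = 0) (hd : DifferentiableAt ℝ P α) : fderiv ℝ P α w = 0 := by
  cases nonempty_fintype ι
  have hconst : (fun t : ℝ => P (α + t • w)) = fun _ => P α := by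
    funext t
    exact hP fun k hk => by simp [hw k hk]
  rw [← hd.lineDeriv_eq_fderiv, lineDeriv, hconst, deriv_const]

end Calculus

section PoissonMaps

/-- The value at `z` of the Hamiltonian vector field, for the Poisson bracket
`ρ² (∂f/∂u ∂g/∂v - ∂f/∂v ∂g/∂u)` on the disc, of a function with differential `ℓ` at `z`. -/
def discHamVec (z : ℂ) (ℓ : ℂ → ℝ) : ℂ :=
  (rho z : ℂ) ^ 2 * (-ℓ Complex.I + ℓ 1 * Complex.I)

variable {m n : ℕ} {α : Fin m → ℂ} {P Q : (Fin m → ℂ) → Matrix (Fin n) (Fin n) ℂ}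

/-- The value at `α` of the Hamiltonian vector field, for the Ablowitz–Ladik bracket, of a function
with differential `ℓ` at `α`. -/
def alHamVec (α : Fin m → ℂ) (ℓ : (Fin m → ℂ) → ℝ) : Fin m → ℂ :=
  fun k => discHamVec (α k) fun w => ℓ (Pi.single k w)

theorem alHamVec_add (α : Fin m → ℂ) (ℓ ℓ' : (Fin m → ℂ) → ℝ) :
    alHamVec α (fun w => ℓ w + ℓ' w) = alHamVec α ℓ + alHamVec α ℓ' := by
  funext k
  simp only [alHamVec, discHamVec, Pi.add_apply, Complex.ofReal_add]
  ring

theorem fderiv_alHamVec_eq_zero_of_disjoint {s t : Set (Fin m)} (hP : DependsOn P s)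
    (hQ : DependsOn Q t) (hst : Disjoint s t) (hdP : DifferentiableAt ℝ P α)
    (hdQ : DifferentiableAt ℝ Q α) (X : Matrix (Fin n) (Fin n) ℂ) :
    fderiv ℝ P α (alHamVec α fun w => pairing X (fderiv ℝ Q α w)) = 0 := by
  refine fderiv_eq_zero_of_dependsOn hP (fun k hks => ?_) hdP
  have hzero : ∀ w : ℂ, fderiv ℝ Q α (Pi.single k w) = 0 := fun w =>
    fderiv_eq_zero_of_dependsOn hQ (fun l hlt =>
      Pi.single_eq_of_ne (ne_of_mem_of_not_mem hlt (hst.notMem_of_mem_left hks)) _) hdQ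
  simp [alHamVec, discHamVec, hzero, pairing_zero_right]

/-- `P` is a Poisson map at `α`, from the polydisc with the Ablowitz–Ladik bracket to the matrices
with the Gelfand–Dikij bracket: its differential relates the Hamiltonian vectors of a linear
functional `⟨X, ·⟩` and of its pullback. -/
def IsPoissonAt (P : (Fin m → ℂ) → Matrix (Fin n) (Fin n) ℂ) (α : Fin m → ℂ) : Prop :=
  ∀ X, hamVec X (P α) = fderiv ℝ P α (alHamVec α fun w => pairing X (fderiv ℝ P α w))

theorem IsPoissonAt.mul {s t : Set (Fin m)} (hP : IsPoissonAt P α) (hQ : IsPoissonAt Q α)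
    (hdP : DifferentiableAt ℝ P α) (hdQ : DifferentiableAt ℝ Q α) (hPs : DependsOn P s)
    (hQt : DependsOn Q t) (hst : Disjoint s t) : IsPoissonAt (fun β => P β * Q β) α := by
  intro X
  have hpair : ∀ w, pairing X (fderiv ℝ (fun β => P β * Q β) α w) =
      pairing (Q α * X) (fderiv ℝ P α w) + pairing (X * P α) (fderiv ℝ Q α w) := fun w => by
    rw [fderiv_matrix_mul hdP hdQ, pairing_add_right, pairing_mul_right X (P α),
      pairing_mul_left X _ (Q α), add_comm]
  have hPQ := fderiv_alHamVec_eq_zero_of_disjoint hPs hQt hst hdP hdQ (X * P α)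
  have hQP := fderiv_alHamVec_eq_zero_of_disjoint hQt hPs hst.symm hdQ hdP (Q α * X)
  simp only [hpair, alHamVec_add]
  rw [fderiv_matrix_mul hdP hdQ, map_add, map_add, hPQ, hQP, zero_add, add_zero, ← hP, ← hQ,
    hamVec_mul, add_comm]

/-- The Ablowitz–Ladik bracket of real functions. -/
def alBracketReal (f g : (Fin m → ℂ) → ℝ) (α : Fin m → ℂ) : ℝ :=
  ∑ j, rho (α j) ^ 2 *
    (fderiv ℝ f α (Pi.single j 1) * fderiv ℝ g α (Pi.single j Complex.I) -
      fderiv ℝ f α (Pi.single j Complex.I) * fderiv ℝ g α (Pi.single j 1))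

theorem fderiv_alHamVec (f g : (Fin m → ℂ) → ℝ) (α : Fin m → ℂ) :
    fderiv ℝ g α (alHamVec α (fderiv ℝ f α)) = alBracketReal f g α := by
  set ℓ := fderiv ℝ f α with hℓ
  have hsum : alHamVec α ℓ = ∑ j, rho (α j) ^ 2 •
      (ℓ (Pi.single j 1) • (Pi.single j Complex.I : Fin m → ℂ) -
        ℓ (Pi.single j Complex.I) • (Pi.single j 1 : Fin m → ℂ)) := by
    rw [← Finset.univ_sum_single (alHamVec α ℓ)]
    refine Finset.sum_congr rfl fun j _ => ?_
    rw [← Pi.single_smul, ← Pi.single_smul, ← Pi.single_sub, ← Pi.single_smul]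
    congr 1
    simp only [alHamVec, discHamVec, Complex.real_smul]
    push_cast
    ring
  simp only [hsum, alBracketReal, map_sum, map_smul, map_sub, smul_eq_mul, ← hℓ]

theorem gdBracketReal_eq_alBracketReal (hP : IsPoissonAt P α) (hd : DifferentiableAt ℝ P α)
    {φ ψ : Matrix (Fin n) (Fin n) ℂ → ℝ} (hφ : DifferentiableAt ℝ φ (P α))
    (hψ : DifferentiableAt ℝ ψ (P α)) :
    gdBracketReal φ ψ (P α) = alBracketReal (φ ∘ P) (ψ ∘ P) α := by
  have hcomp : ∀ {χ : Matrix (Fin n) (Fin n) ℂ → ℝ}, DifferentiableAt ℝ χ (P α) → ∀ w,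
      fderiv ℝ χ (P α) (fderiv ℝ P α w) = fderiv ℝ (χ ∘ P) α w := fun hχ w =>
    (congrArg (· w) (fderiv_comp α hχ hd)).symm
  rw [gdBracketReal_eq_fderiv_hamVec, hP, hcomp hψ, ← fderiv_alHamVec]
  simp only [pairing_grad, hcomp hφ]

theorem alBracket_eq_alBracketReal {f g : (Fin m → ℂ) → ℂ} (hf : DifferentiableAt ℝ f α)
    (hg : DifferentiableAt ℝ g α) :
    alBracket f g α =
      alBracketReal (Complex.re ∘ f) (Complex.re ∘ g) α
        - alBracketReal (Complex.im ∘ f) (Complex.im ∘ g) α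
        + Complex.I * (alBracketReal (Complex.re ∘ f) (Complex.im ∘ g) α
          + alBracketReal (Complex.im ∘ f) (Complex.re ∘ g) α) := by
  have hre : ∀ {h : (Fin m → ℂ) → ℂ}, DifferentiableAt ℝ h α → ∀ w,
      fderiv ℝ (Complex.re ∘ h) α w = (fderiv ℝ h α w).re := fun hh w =>
    congrArg (· w) (Complex.reCLM.hasFDerivAt.comp α hh.hasFDerivAt).fderiv
  have him : ∀ {h : (Fin m → ℂ) → ℂ}, DifferentiableAt ℝ h α → ∀ w,
      fderiv ℝ (Complex.im ∘ h) α w = (fderiv ℝ h α w).im := fun hh w =>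
    congrArg (· w) (Complex.imCLM.hasFDerivAt.comp α hh.hasFDerivAt).fderiv
  simp only [alBracket, alBracketReal, partialU, partialV, hre hf, hre hg, him hf, him hg,
    Complex.ofReal_sum, Finset.mul_sum, ← Finset.sum_add_distrib, ← Finset.sum_sub_distrib]
  refine Finset.sum_congr rfl fun j _ => ?_
  apply Complex.ext <;> simp <;> ring

theorem gdBracket_eq_alBracket (hP : IsPoissonAt P α) (hd : DifferentiableAt ℝ P α)
    {F G : Matrix (Fin n) (Fin n) ℂ → ℂ} (hF : DifferentiableAt ℝ F (P α))
    (hG : DifferentiableAt ℝ G (P α)) :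
    gdBracket F G (P α) = alBracket (F ∘ P) (G ∘ P) α := by
  have hre : ∀ {H : Matrix (Fin n) (Fin n) ℂ → ℂ}, DifferentiableAt ℝ H (P α) →
      DifferentiableAt ℝ (fun M => (H M).re) (P α) := fun hH =>
    Complex.reCLM.differentiableAt.comp _ hH
  have him : ∀ {H : Matrix (Fin n) (Fin n) ℂ → ℂ}, DifferentiableAt ℝ H (P α) →
      DifferentiableAt ℝ (fun M => (H M).im) (P α) := fun hH =>
    Complex.imCLM.differentiableAt.comp _ hH
  rw [alBracket_eq_alBracketReal (hF.comp α hd) (hG.comp α hd), gdBracket,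
    gdBracketReal_eq_alBracketReal hP hd (hre hF) (hre hG),
    gdBracketReal_eq_alBracketReal hP hd (him hF) (him hG),
    gdBracketReal_eq_alBracketReal hP hd (hre hF) (him hG),
    gdBracketReal_eq_alBracketReal hP hd (him hF) (hre hG)]
  rfl

end PoissonMaps

section TwoByTwoBlock

variable {z : ℂ}

theorem one_sub_norm_sq_pos (hz : ‖z‖ < 1) : 0 < 1 - ‖z‖ ^ 2 := by
  nlinarith [norm_nonneg z]

theorem rho_pos (hz : ‖z‖ < 1) : 0 < rho z :=
  Real.sqrt_pos.mpr (one_sub_norm_sq_pos hz)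

theorem rho_sq (hz : ‖z‖ < 1) : rho z ^ 2 = 1 - ‖z‖ ^ 2 :=
  Real.sq_sqrt (one_sub_norm_sq_pos hz).le

theorem contDiffAt_rho {n : WithTop ℕ∞} (hz : ‖z‖ < 1) : ContDiffAt ℝ n rho z :=
  (contDiffAt_const.sub (contDiff_norm_sq ℝ).contDiffAt).sqrt (one_sub_norm_sq_pos hz).ne'

theorem fderiv_rho (hz : ‖z‖ < 1) (w : ℂ) : fderiv ℝ rho z w = -(star z * w).re / rho z := by
  have hsq := (hasStrictFDerivAt_norm_sq (F := ℂ) z).hasFDerivAt.const_sub 1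
  have hrho := (hsq.sqrt (one_sub_norm_sq_pos hz).ne').fderiv
  change fderiv ℝ rho z = (1 / (2 * rho z)) • _ at hrho
  have hpos := (rho_pos hz).ne'
  rw [hrho]
  simp
  field_simp
  ring

theorem differentiableAt_Xi (hz : ‖z‖ < 1) : DifferentiableAt ℝ Xi z := by
  have hrho : DifferentiableAt ℝ (fun y => (rho y : ℂ)) z :=
    Complex.ofRealCLM.differentiableAt.comp z ((contDiffAt_rho hz).differentiableAt one_ne_zero)
  refine differentiableAt_pi.2 fun i => differentiableAt_pi.2 fun j => ?_
  fin_cases i <;> fin_cases j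
  · exact (Complex.conjCLE : ℂ →L[ℝ] ℂ).differentiableAt
  · exact hrho
  · exact hrho
  · exact differentiableAt_id.neg

theorem fderiv_Xi (hz : ‖z‖ < 1) (w : ℂ) :
    fderiv ℝ Xi z w = !![star w, ((-(star z * w).re / rho z : ℝ) : ℂ);
      ((-(star z * w).re / rho z : ℝ) : ℂ), -w] := by
  have hrho : fderiv ℝ (fun y => (rho y : ℂ)) z w = ((-(star z * w).re / rho z : ℝ) : ℂ) := by
    rw [← fderiv_rho hz]
    exact congrArg (· w) (Complex.ofRealCLM.hasFDerivAt.comp z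
      ((contDiffAt_rho hz).differentiableAt one_ne_zero).hasFDerivAt).fderiv
  ext i j
  rw [fderiv_matrix_apply (differentiableAt_Xi hz)]
  fin_cases i <;> fin_cases j
  · exact congrArg (· w) (Complex.conjCLE : ℂ →L[ℝ] ℂ).fderiv
  · exact hrho
  · exact hrho
  · exact congrArg (· w) (hasFDerivAt_id (𝕜 := ℝ) z).neg.fderiv

theorem Xi_mem_unitaryGroup (hz : ‖z‖ < 1) : Xi z ∈ unitaryGroup (Fin 2) ℂ := by
  have hrho : (rho z : ℂ) * rho z = 1 - z * star z := by
    rw [Complex.star_def, Complex.mul_conj, Complex.normSq_eq_norm_sq, ← Complex.ofReal_mul, ← sq,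
      rho_sq hz]
    push_cast
    rfl
  rw [mem_unitaryGroup_iff]
  ext i j
  fin_cases i <;> fin_cases j <;>
    simp [Xi, mul_apply, Fin.sum_univ_two, star_eq_conjTranspose, hrho] <;> ring

theorem discHamVec_Xi (hz : ‖z‖ < 1) (X : Matrix (Fin 2) (Fin 2) ℂ) :
    discHamVec z (fun w => pairing X (fderiv ℝ Xi z w)) =
      rho z * (rho z * (X 0 0 + star (X 1 1)) - Complex.I * z * (X 0 1 + X 1 0).im) := by
  have hpos := (rho_pos hz).ne'
  simp only [discHamVec, fderiv_Xi hz, pairing, trace_fin_two, mul_apply, Fin.sum_univ_two]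
  apply Complex.ext <;> simp [sq] <;> field_simp <;> ring

theorem projA_fin_two (X : Matrix (Fin 2) (Fin 2) ℂ) :
    projA X = !![Complex.I * (X 0 0).im, X 0 1; -star (X 0 1), Complex.I * (X 1 1).im] := by
  ext i j
  fin_cases i <;> fin_cases j <;> simp [projA]

theorem hamVec_Xi (hz : ‖z‖ < 1) (X : Matrix (Fin 2) (Fin 2) ℂ) :
    hamVec X (Xi z) = fderiv ℝ Xi z (discHamVec z fun w => pairing X (fderiv ℝ Xi z w)) := by
  have hpos := (rho_pos hz).ne'
  rw [discHamVec_Xi hz, fderiv_Xi hz, hamVec, projA_fin_two, projA_fin_two]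
  ext i j
  fin_cases i <;> fin_cases j <;> apply Complex.ext <;>
    simp [Xi, mul_apply, Fin.sum_univ_two] <;> field_simp <;> ring

end TwoByTwoBlock

section XiBlocks

variable {m p : ℕ}

/-- The two indices of the block `Ξ_k`. -/
def pair (k : Fin m) : Fin 2 → Fin (m + 1) := ![k.castSucc, k.succ]

/-- A labelling of the indices whose fibres are the pairs `{k, k + 1}` with `k + p` even, together
with the singletons that remain at either end. -/
def pairLabel (p : ℕ) (i : Fin (m + 1)) : ℕ := (i + p) / 2

theorem strictMono_pair (k : Fin m) : StrictMono (pair k) :=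
  Fin.strictMono_iff_lt_succ.2 fun s => by fin_cases s; exact k.castSucc_lt_succ

theorem monotone_pairLabel : Monotone (pairLabel (m := m) p) :=
  fun _ _ hij => Nat.div_le_div_right (Nat.add_le_add_right hij p)

theorem mem_range_pair {k : Fin m} {i : Fin (m + 1)} :
    i ∈ range (pair k) ↔ (i : ℕ) = k ∨ (i : ℕ) = k + 1 := by
  simp [pair, Fin.ext_iff, eq_comm, or_comm]

theorem mem_range_pair_of_pairLabel_eq {k : Fin m} (hk : Even (k + p)) (s : Fin 2)
    (j : Fin (m + 1)) (hj : pairLabel p j = pairLabel p (pair k s)) : j ∈ range (pair k) := by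
  have hs := mem_range_pair.1 (mem_range_self (f := pair k) s)
  rw [mem_range_pair]
  rw [pairLabel, pairLabel] at hj
  grind

theorem eq_or_exists_pair_of_pairLabel_eq {i j : Fin (m + 1)}
    (hij : pairLabel p i = pairLabel p j) :
    i = j ∨ ∃ k : Fin m, Even (k + p) ∧ i ∈ range (pair k) ∧ j ∈ range (pair k) := by
  simp only [pairLabel, mem_range_pair] at hij ⊢
  rcases lt_trichotomy i j with h | h | h
  · exact .inr ⟨⟨i, by omega⟩, by rw [Nat.even_iff]; grind, by grind⟩
  · exact .inl h
  · exact .inr ⟨⟨j, by omega⟩, by rw [Nat.even_iff]; grind, by grind⟩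

theorem IsBlockDiag.ext_pair {R : Type*} [Zero R] {A B : Matrix (Fin (m + 1)) (Fin (m + 1)) R}
    (hA : IsBlockDiag (pairLabel p) A) (hB : IsBlockDiag (pairLabel p) B)
    (hpair : ∀ k : Fin m, Even (k + p) →
      A.submatrix (pair k) (pair k) = B.submatrix (pair k) (pair k))
    (hself : ∀ i, (∀ k : Fin m, Even (k + p) → i ∉ range (pair k)) → A i i = B i i) : A = B := by
  have hcell : ∀ (k : Fin m), Even (k + p) → ∀ s t, A (pair k s) (pair k t) =
      B (pair k s) (pair k t) := fun k hk => congrFun₂ (hpair k hk)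
  ext i j
  by_cases hij : pairLabel p i = pairLabel p j
  · rcases eq_or_exists_pair_of_pairLabel_eq hij with rfl | ⟨k, hk, ⟨s, rfl⟩, ⟨t, rfl⟩⟩
    · by_cases hi : ∃ k : Fin m, Even (k + p) ∧ i ∈ range (pair k)
      · obtain ⟨k, hk, s, rfl⟩ := hi
        exact hcell k hk s s
      · exact hself i fun k hk hik => hi ⟨k, hk, hik⟩
    · exact hcell k hk s t
  · rw [hA hij, hB hij]

theorem hasFDerivAt_Xi_apply {α : Fin m → ℂ} {k : Fin m} (hk : ‖α k‖ < 1) :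
    HasFDerivAt (fun β : Fin m → ℂ => Xi (β k))
      ((fderiv ℝ Xi (α k)).comp (ContinuousLinearMap.proj (R := ℝ) (φ := fun _ : Fin m => ℂ) k))
      α :=
  HasFDerivAt.comp (g := Xi) α (differentiableAt_Xi hk).hasFDerivAt
    (ContinuousLinearMap.proj (R := ℝ) (φ := fun _ : Fin m => ℂ) k).hasFDerivAt

/-- `P α` is block diagonal with the `2 × 2` blocks `Ξ(α_k)`, where `k + p` is even, at the indices
`k` and `k + 1`, and with constant unimodular `1 × 1` blocks at the remaining indices. -/
structure IsXiBlockDiag (p : ℕ) (P : (Fin m → ℂ) → Matrix (Fin (m + 1)) (Fin (m + 1)) ℂ) :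
    Prop where
  isBlockDiag : ∀ α, IsBlockDiag (pairLabel p) (P α)
  submatrix_pair : ∀ α (k : Fin m), Even (k + p) → (P α).submatrix (pair k) (pair k) = Xi (α k)
  exists_apply_self : ∀ i, (∀ k : Fin m, Even (k + p) → i ∉ range (pair k)) →
    ∃ c : ℂ, ‖c‖ = 1 ∧ ∀ α, P α i i = c

namespace IsXiBlockDiag

variable {P : (Fin m → ℂ) → Matrix (Fin (m + 1)) (Fin (m + 1)) ℂ} {α : Fin m → ℂ}

theorem apply_pair (hP : IsXiBlockDiag p P) (α : Fin m → ℂ) {k : Fin m} (hk : Even (k + p))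
    (s t : Fin 2) : P α (pair k s) (pair k t) = Xi (α k) s t :=
  congrFun₂ (hP.submatrix_pair α k hk) s t

theorem exists_const_or_mem_pair (hP : IsXiBlockDiag p P) (i j : Fin (m + 1)) :
    (∃ c, ∀ α, P α i j = c) ∨
      ∃ k : Fin m, Even (k + p) ∧ i ∈ range (pair k) ∧ j ∈ range (pair k) := by
  by_cases hij : pairLabel p i = pairLabel p j
  · rcases eq_or_exists_pair_of_pairLabel_eq hij with rfl | hk
    · by_cases hi : ∃ k : Fin m, Even (k + p) ∧ i ∈ range (pair k)
      · obtain ⟨k, hk, hik⟩ := hi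
        exact .inr ⟨k, hk, hik, hik⟩
      · obtain ⟨c, -, hc⟩ := hP.exists_apply_self i fun k hk hik => hi ⟨k, hk, hik⟩
        exact .inl ⟨c, hc⟩
    · exact .inr hk
  · exact .inl ⟨0, fun α => hP.isBlockDiag α hij⟩

theorem dependsOn (hP : IsXiBlockDiag p P) : DependsOn P {k | Even (k + p)} := by
  intro α β hαβ
  ext i j
  rcases hP.exists_const_or_mem_pair i j with ⟨c, hc⟩ | ⟨k, hk, ⟨s, rfl⟩, ⟨t, rfl⟩⟩
  · rw [hc, hc]
  · rw [hP.apply_pair α hk, hP.apply_pair β hk, hαβ k hk]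

theorem mem_unitaryGroup (hP : IsXiBlockDiag p P) (hα : α ∈ polydisc m) :
    P α ∈ unitaryGroup (Fin (m + 1)) ℂ := by
  have hB := hP.isBlockDiag α
  rw [mem_unitaryGroup_iff, star_eq_conjTranspose]
  refine (hB.mul hB.conjTranspose).ext_pair .one (fun k hk => ?_) fun i hi => ?_
  · rw [hB.submatrix_mul_left (strictMono_pair k).injective (mem_range_pair_of_pairLabel_eq hk),
      ← conjTranspose_submatrix, hP.submatrix_pair α k hk,
      submatrix_one _ (strictMono_pair k).injective]
    exact Unitary.mul_star_self_of_mem (Xi_mem_unitaryGroup (hα k))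
  · obtain ⟨c, hc, hci⟩ := hP.exists_apply_self i hi
    rw [hB.mul_apply_eq_single hB.conjTranspose i fun l hl _ => ?_, conjTranspose_apply, hci,
      one_apply_eq, Complex.star_def, Complex.mul_conj, Complex.normSq_eq_norm_sq, hc]
    · simp
    · rcases eq_or_exists_pair_of_pairLabel_eq hl with h | ⟨k, hk, hik, -⟩
      · exact h.symm
      · exact absurd hik (hi k hk)

theorem differentiableAt (hP : IsXiBlockDiag p P) (hα : α ∈ polydisc m) :
    DifferentiableAt ℝ P α := by
  refine differentiableAt_pi.2 fun i => differentiableAt_pi.2 fun j => ?_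
  rcases hP.exists_const_or_mem_pair i j with ⟨c, hc⟩ | ⟨k, hk, ⟨s, rfl⟩, ⟨t, rfl⟩⟩
  · simp only [hc, differentiableAt_const]
  · simp only [hP.apply_pair _ hk]
    exact differentiableAt_pi.1 (differentiableAt_pi.1
      (hasFDerivAt_Xi_apply (hα k)).differentiableAt s) t

theorem fderiv_apply_pair (hP : IsXiBlockDiag p P) (hα : α ∈ polydisc m) (w : Fin m → ℂ)
    {k : Fin m} (hk : Even (k + p)) (s t : Fin 2) :
    fderiv ℝ P α w (pair k s) (pair k t) = fderiv ℝ Xi (α k) (w k) s t := by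
  have hXi := hasFDerivAt_Xi_apply (hα k)
  rw [fderiv_matrix_apply (hP.differentiableAt hα)]
  simp only [hP.apply_pair _ hk]
  rw [← fderiv_matrix_apply hXi.differentiableAt, hXi.fderiv]
  rfl

theorem fderiv_apply_of_const (hP : IsXiBlockDiag p P) (hα : α ∈ polydisc m) (w : Fin m → ℂ)
    {i j : Fin (m + 1)} {c : ℂ} (hc : ∀ β, P β i j = c) : fderiv ℝ P α w i j = 0 := by
  rw [fderiv_matrix_apply (hP.differentiableAt hα)]
  simp [hc]

theorem pairing_fderiv_single (hP : IsXiBlockDiag p P) (hα : α ∈ polydisc m) {k : Fin m}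
    (hk : Even (k + p)) (X : Matrix (Fin (m + 1)) (Fin (m + 1)) ℂ) (w : ℂ) :
    pairing X (fderiv ℝ P α (Pi.single k w)) =
      pairing (X.submatrix (pair k) (pair k)) (fderiv ℝ Xi (α k) w) := by
  rw [pairing_eq_pairing_submatrix (strictMono_pair k).injective X]
  · congr 1
    ext s t
    rw [submatrix_apply, hP.fderiv_apply_pair hα _ hk, Pi.single_eq_same]
  · intro i j hij
    rcases hP.exists_const_or_mem_pair i j with ⟨c, hc⟩ | ⟨l, hl, ⟨s, rfl⟩, ⟨t, rfl⟩⟩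
    · exact hP.fderiv_apply_of_const hα _ hc
    · have hlk : l ≠ k := by
        rintro rfl
        exact hij ⟨mem_range_self s, mem_range_self t⟩
      rw [hP.fderiv_apply_pair hα _ hl, Pi.single_eq_of_ne hlk, map_zero, Matrix.zero_apply]

theorem isPoissonAt (hP : IsXiBlockDiag p P) (hα : α ∈ polydisc m) : IsPoissonAt P α := by
  intro X
  have hB := hP.isBlockDiag α
  refine (isBlockDiag_hamVec monotone_pairLabel hB (hP.mem_unitaryGroup hα) X).ext_pair
    (fun i j hij => hP.fderiv_apply_of_const hα _ fun β => hP.isBlockDiag β hij)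
    (fun k hk => ?_) fun i hi => ?_
  · rw [hamVec_submatrix hB (strictMono_pair k) (mem_range_pair_of_pairLabel_eq hk),
      hP.submatrix_pair α k hk, hamVec_Xi (hα k)]
    ext s t
    rw [submatrix_apply, hP.fderiv_apply_pair hα _ hk]
    simp only [alHamVec, hP.pairing_fderiv_single hα hk]
  · obtain ⟨c, -, hc⟩ := hP.exists_apply_self i hi
    rw [hP.fderiv_apply_of_const hα _ hc]
    refine hamVec_apply_self_of_singleton_block hB (fun j hj => ?_) X
    rcases eq_or_exists_pair_of_pairLabel_eq hj with h | ⟨k, hk, -, hik⟩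
    · exact h
    · exact absurd hik (hi k hk)

end IsXiBlockDiag

end XiBlocks

section CMVFactors

variable {m p : ℕ} {a : ℂ} {α : Fin m → ℂ}

theorem ofNat_two_of_even {k : ℕ} (hk : Even k) : Fin.ofNat 2 k = 0 :=
  Fin.ext (Nat.even_iff.1 hk)

theorem ofNat_two_of_odd {k : ℕ} (hk : Odd k) : Fin.ofNat 2 k = 1 :=
  Fin.ext (Nat.odd_iff.1 hk)

theorem coeff_val (k : Fin m) : coeff a α k = α k :=
  dif_pos k.2

theorem eq_zero_or_eq_last_of_forall_notMem_pair {i : Fin (m + 1)}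
    (hi : ∀ k : Fin m, Even (k + p) → i ∉ range (pair k)) :
    i = 0 ∧ Odd p ∨ (i : ℕ) = m ∧ Even (m + p) := by
  simp only [mem_range_pair, not_or] at hi
  by_cases hip : Even (i + p)
  · have hlast : ¬(i : ℕ) < m := fun h => (hi ⟨i, h⟩ hip).1 rfl
    grind
  · have hi0 : (i : ℕ) = 0 := by
      by_contra h0
      exact (hi ⟨i - 1, by grind⟩ (by grind)).2 (by grind)
    exact .inl ⟨Fin.ext hi0, by grind⟩

theorem matL_submatrix_pair (a : ℂ) (α : Fin m → ℂ) {k : Fin m} (hk : Even (k : ℕ)) :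
    (matL a α).submatrix (pair k) (pair k) = Xi (α k) := by
  have hdiv : 2 * ((k : ℕ) / 2) = k := Nat.two_mul_div_two_of_even hk
  have hdiv' : ((k : ℕ) + 1) / 2 = k / 2 := by omega
  rw [← coeff_val (a := a) (α := α) k]
  ext s t
  fin_cases s <;> fin_cases t <;>
    simp only [submatrix_apply, pair, matL, Matrix.of_apply, Fin.zero_eta, Fin.mk_one,
      cons_val_zero, cons_val_one, Fin.val_castSucc, Fin.val_succ, hdiv', hdiv, if_true,
      ofNat_two_of_even hk, ofNat_two_of_odd hk.add_one]

theorem isBlockDiag_matL (a : ℂ) (α : Fin m → ℂ) : IsBlockDiag (pairLabel 0) (matL a α) :=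
  fun _ _ hij => if_neg hij

theorem isXiBlockDiag_matL (ha : ‖a‖ = 1) : IsXiBlockDiag (m := m) 0 (matL a) where
  isBlockDiag := isBlockDiag_matL a
  submatrix_pair α _ hk := matL_submatrix_pair a α hk
  exists_apply_self i hi := by
    obtain ⟨-, h0⟩ | ⟨him, hm⟩ := eq_zero_or_eq_last_of_forall_notMem_pair hi
    · exact absurd h0 Nat.not_odd_zero
    · refine ⟨star a, by rwa [norm_star], fun α => ?_⟩
      have hdiv : 2 * (m / 2) = m := Nat.two_mul_div_two_of_even hm
      rw [matL, Matrix.of_apply, if_pos rfl, him, hdiv, ofNat_two_of_even (k := m) hm, coeff,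
        dif_neg (lt_irrefl m)]
      rfl

theorem matM_submatrix_pair (a : ℂ) (α : Fin m → ℂ) {k : Fin m} (hk : Odd (k : ℕ)) :
    (matM a α).submatrix (pair k) (pair k) = Xi (α k) := by
  obtain ⟨l, hl⟩ := hk
  have hdiv : ((k : ℕ) - 1) / 2 = l := by omega
  have hdiv' : (k : ℕ) / 2 = l := by omega
  have hk0 : (k : ℕ) ≠ 0 := by omega
  have hodd : Odd (k : ℕ) := ⟨l, hl⟩
  have heven : Even ((k : ℕ) - 1) := ⟨l, by omega⟩
  rw [← coeff_val (a := a) (α := α) k]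
  ext s t
  fin_cases s <;> fin_cases t <;>
    simp only [submatrix_apply, pair, matM, Matrix.of_apply, Fin.zero_eta, Fin.mk_one,
      cons_val_zero, cons_val_one, Fin.val_castSucc, Fin.val_succ, Nat.add_sub_cancel, hdiv', hdiv,
      ← hl, if_true, ofNat_two_of_even heven, ofNat_two_of_odd hodd, hk0, Nat.succ_ne_zero,
      or_self, if_false]

theorem isBlockDiag_matM (a : ℂ) (α : Fin m → ℂ) : IsBlockDiag (pairLabel 1) (matM a α) := by
  intro i j hij
  simp only [pairLabel] at hij
  simp only [matM, Matrix.of_apply]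
  split_ifs <;> grind

theorem isXiBlockDiag_matM (ha : ‖a‖ = 1) : IsXiBlockDiag (m := m) 1 (matM a) where
  isBlockDiag := isBlockDiag_matM a
  submatrix_pair α _ hk := matM_submatrix_pair a α (by grind)
  exists_apply_self i hi := by
    obtain ⟨rfl, -⟩ | ⟨him, hm⟩ := eq_zero_or_eq_last_of_forall_notMem_pair hi
    · exact ⟨1, norm_one, fun α => by simp [matM]⟩
    · refine ⟨star a, by rwa [norm_star], fun α => ?_⟩
      have hm' : m ≠ 0 := by grind
      have heven : Even (m - 1) := by grind
      have hdiv : 2 * ((m - 1) / 2) + 1 = m := by grind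
      rw [matM, Matrix.of_apply, him, if_neg (by simp [hm']), if_pos rfl, hdiv,
        ofNat_two_of_even heven, coeff, dif_neg (lt_irrefl m)]
      rfl

end CMVFactors

section CMVMatrices

variable {m : ℕ} {a : ℂ} {α : Fin m → ℂ}

theorem differentiableAt_cmv (ha : ‖a‖ = 1) (hα : α ∈ polydisc m) :
    DifferentiableAt ℝ (cmv a) α :=
  differentiableAt_matrix_mul ((isXiBlockDiag_matL ha).differentiableAt hα)
    ((isXiBlockDiag_matM ha).differentiableAt hα)

theorem isPoissonAt_cmv (ha : ‖a‖ = 1) (hα : α ∈ polydisc m) : IsPoissonAt (cmv a) α := by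
  have hL := isXiBlockDiag_matL (m := m) ha
  have hM := isXiBlockDiag_matM (m := m) ha
  refine (hL.isPoissonAt hα).mul (hM.isPoissonAt hα) (hL.differentiableAt hα)
    (hM.differentiableAt hα) hL.dependsOn hM.dependsOn (disjoint_left.2 fun k hk hk' => ?_)
  exact Nat.even_add_one.1 hk' hk

end CMVMatrices

section SmoothExtension

variable {m : ℕ} {a : ℂ}

theorem cmv_zero_zero (α : Fin m → ℂ) {k : Fin m} (hk : (k : ℕ) = 0) :
    cmv a α 0 0 = star (α k) := by
  have hk0 : pair k 0 = 0 := Fin.ext hk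
  have hL := congrFun₂ (matL_submatrix_pair a α (hk ▸ Even.zero)) 0 0
  rw [submatrix_apply, hk0] at hL
  rw [cmv, (isBlockDiag_matL a α).mul_apply_eq_single (isBlockDiag_matM a α) 0, hL]
  · simp [matM, Xi]
  · intro i _ hi
    simp only [pairLabel, Fin.val_zero] at hi
    exact Fin.ext (show (i : ℕ) = 0 by omega)

theorem exists_cmv_apply_eq {k l : Fin m} (hkl : (l : ℕ) = k + 1) :
    ∃ i j, ∀ α, cmv a α i j = rho (α k) * star (α l) := by
  have hpair : pair k 1 = pair l 0 := Fin.ext hkl.symm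
  rcases Nat.even_or_odd k with hk | hk
  · have hl : Odd (l : ℕ) := hkl ▸ hk.add_one
    refine ⟨pair k 0, pair l 0, fun α => ?_⟩
    have hL := congrFun₂ (matL_submatrix_pair a α hk) 0 1
    have hM := congrFun₂ (matM_submatrix_pair a α hl) 0 0
    rw [submatrix_apply] at hL hM
    rw [cmv, (isBlockDiag_matL a α).mul_apply_eq_single (isBlockDiag_matM a α) (pair k 1), hL,
      hpair, hM]
    · rfl
    · intro i hki hil
      simp only [pairLabel, pair, cons_val_zero, Fin.val_castSucc] at hki hil
      exact Fin.ext (show (i : ℕ) = k + 1 by grind)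
  · have hl : Even (l : ℕ) := hkl ▸ hk.add_one
    refine ⟨pair l 0, pair k 0, fun α => ?_⟩
    have hL := congrFun₂ (matL_submatrix_pair a α hl) 0 0
    have hM := congrFun₂ (matM_submatrix_pair a α hk) 1 0
    rw [submatrix_apply] at hL hM
    rw [cmv, (isBlockDiag_matL a α).mul_apply_eq_single (isBlockDiag_matM a α) (pair k 1), hM,
      hpair, hL, mul_comm]
    · rfl
    · intro i hli hik
      simp only [pairLabel, pair, cons_val_zero, Fin.val_castSucc] at hli hik
      exact Fin.ext (show (i : ℕ) = k + 1 by grind)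

theorem isSmoothExtension_entry (a : ℂ) (i j : Fin (m + 1)) :
    IsSmoothExtension a (fun α : Fin m → ℂ => cmv a α i j) fun C => C i j :=
  ⟨⟨univ, isOpen_univ, fun _ _ => mem_univ _, (contDiff_apply_apply ℝ ℂ i j).contDiffOn⟩,
    fun _ _ => rfl⟩

theorem IsSmoothExtension.comp {ι : Type*} [Fintype ι] {f : ι → (Fin m → ℂ) → ℂ}
    {F : ι → Matrix (Fin (m + 1)) (Fin (m + 1)) ℂ → ℂ} {g : (ι → ℂ) → ℂ} {V : Set (ι → ℂ)}
    (hF : ∀ i, IsSmoothExtension a (f i) (F i)) (hV : IsOpen V)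
    (hg : ContDiffOn ℝ (⊤ : ℕ∞) g V) (hfV : ∀ α ∈ polydisc m, (fun i => f i α) ∈ V) :
    IsSmoothExtension a (fun α => g fun i => f i α) fun C => g fun i => F i C := by
  have hFf : ∀ α ∈ polydisc m, (fun i => F i (cmv a α)) = fun i => f i α :=
    fun α hα => funext fun i => (hF i).2 α hα
  choose U hUo hUα hFU using fun i => (hF i).1
  have hF' : ContDiffOn ℝ (⊤ : ℕ∞) (fun C i => F i C) (⋂ i, U i) :=
    contDiffOn_pi.2 fun i => (hFU i).mono (iInter_subset U i)
  refine ⟨⟨(⋂ i, U i) ∩ (fun C i => F i C) ⁻¹' V,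
    hF'.continuousOn.isOpen_inter_preimage (isOpen_iInter_of_finite hUo) hV,
    fun α hα => ⟨mem_iInter.2 fun i => hUα i α hα, ?_⟩,
    hg.comp (hF'.mono inter_subset_left) inter_subset_right⟩,
    fun α hα => congrArg g (hFf α hα)⟩
  rw [mem_preimage, hFf α hα]
  exact hfV α hα

theorem contDiffOn_inv_rho_smul_star : ContDiffOn ℝ (⊤ : ℕ∞)
    (fun z : Fin 2 → ℂ => (rho (z 0))⁻¹ • star (z 1)) {z | ‖z 0‖ < 1} := by
  intro z hz
  have hrho : ContDiffAt ℝ (⊤ : ℕ∞) (fun z : Fin 2 → ℂ => rho (z 0)) z :=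
    ContDiffAt.comp (g := rho) z (contDiffAt_rho hz) (contDiff_apply ℝ ℂ 0).contDiffAt
  have hstar : ContDiff ℝ (⊤ : ℕ∞) fun z : Fin 2 → ℂ => star (z 1) :=
    Complex.conjCLE.contDiff.comp (contDiff_apply ℝ ℂ 1)
  exact ((hrho.inv (rho_pos hz).ne').smul hstar.contDiffAt).contDiffWithinAt

theorem exists_isSmoothExtension_coord_succ {k l : Fin m} (hkl : (l : ℕ) = k + 1)
    {F : Matrix (Fin (m + 1)) (Fin (m + 1)) ℂ → ℂ} (hF : IsSmoothExtension a (fun α => α k) F) :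
    ∃ G, IsSmoothExtension a (fun α => α l) G := by
  obtain ⟨i, j, hij⟩ := exists_cmv_apply_eq (a := a) hkl
  have hG := IsSmoothExtension.comp (a := a)
    (f := ![fun α => α k, fun α => cmv a α i j]) (F := ![F, fun C => C i j])
    (Fin.forall_fin_two.2 ⟨hF, isSmoothExtension_entry a i j⟩)
    (isOpen_lt (continuous_apply 0).norm continuous_const) contDiffOn_inv_rho_smul_star
    fun α hα => hα k
  refine ⟨_, hG.1, fun α hα => (hG.2 α hα).trans ?_⟩
  simp [hij, (rho_pos (hα k)).ne']

theorem exists_isSmoothExtension_coord (a : ℂ) (k : Fin m) :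
    ∃ F, IsSmoothExtension a (fun α => α k) F := by
  obtain ⟨n, hn⟩ := k
  induction n with
  | zero =>
    have hF := IsSmoothExtension.comp (m := m) (ι := Fin 1) (g := fun z => star (z 0))
      (fun _ => isSmoothExtension_entry a 0 0) isOpen_univ
      (Complex.conjCLE.contDiff.comp (contDiff_apply ℝ ℂ 0)).contDiffOn fun _ _ => mem_univ _
    exact ⟨_, hF.1, fun α hα => (hF.2 α hα).trans (by simp [cmv_zero_zero α (k := ⟨0, hn⟩) rfl])⟩
  | succ n ih =>
    obtain ⟨F, hF⟩ := ih (Nat.lt_of_succ_lt hn)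
    exact exists_isSmoothExtension_coord_succ rfl hF

theorem isOpen_polydisc (m : ℕ) : IsOpen (polydisc m) := by
  simp only [polydisc, ofPred_forall]
  exact isOpen_iInter_of_finite fun k => isOpen_lt (continuous_apply k).norm continuous_const

theorem exists_isSmoothExtension (a : ℂ) {f : (Fin m → ℂ) → ℂ}
    (hf : ContDiffOn ℝ (⊤ : ℕ∞) f (polydisc m)) : ∃ F, IsSmoothExtension a f F := by
  choose F hF using exists_isSmoothExtension_coord (m := m) a
  exact ⟨_, IsSmoothExtension.comp hF (isOpen_polydisc m) hf fun _ hα => hα⟩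

end SmoothExtension

section Conclusion

variable {m : ℕ} {a : ℂ}

theorem alBracket_congr {f f' g g' : (Fin m → ℂ) → ℂ} {α : Fin m → ℂ} (hf : f =ᶠ[nhds α] f')
    (hg : g =ᶠ[nhds α] g') : alBracket f g α = alBracket f' g' α := by
  simp only [alBracket, partialU, partialV, hf.fderiv_eq, hg.fderiv_eq]

theorem IsSmoothExtension.differentiableAt {f : (Fin m → ℂ) → ℂ}
    {F : Matrix (Fin (m + 1)) (Fin (m + 1)) ℂ → ℂ} (hF : IsSmoothExtension a f F) {α : Fin m → ℂ}
    (hα : α ∈ polydisc m) : DifferentiableAt ℝ F (cmv a α) := by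
  obtain ⟨⟨U, hUo, hUα, hFU⟩, -⟩ := hF
  exact (hFU.contDiffAt (hUo.mem_nhds (hUα α hα))).differentiableAt (by simp)

theorem IsSmoothExtension.comp_cmv_eventuallyEq {f : (Fin m → ℂ) → ℂ}
    {F : Matrix (Fin (m + 1)) (Fin (m + 1)) ℂ → ℂ} (hF : IsSmoothExtension a f F) {α : Fin m → ℂ}
    (hα : α ∈ polydisc m) : F ∘ cmv a =ᶠ[nhds α] f :=
  Filter.eventuallyEq_of_mem ((isOpen_polydisc m).mem_nhds hα) hF.2

theorem hasGDBracket_alBracket (ha : ‖a‖ = 1) {f g : (Fin m → ℂ) → ℂ}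
    (hf : ContDiffOn ℝ (⊤ : ℕ∞) f (polydisc m)) (hg : ContDiffOn ℝ (⊤ : ℕ∞) g (polydisc m)) :
    HasGDBracket a f g (alBracket f g) := by
  refine ⟨exists_isSmoothExtension a hf, exists_isSmoothExtension a hg, fun F G hF hG α hα => ?_⟩
  rw [gdBracket_eq_alBracket (isPoissonAt_cmv ha hα) (differentiableAt_cmv ha hα)
    (hF.differentiableAt hα) (hG.differentiableAt hα)]
  exact alBracket_congr (hF.comp_cmv_eventuallyEq hα) (hG.comp_cmv_eventuallyEq hα)

theorem fderiv_coord (k : Fin m) (α w : Fin m → ℂ) :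
    fderiv ℝ (fun β : Fin m → ℂ => β k) α w = w k :=
  congrArg (· w) (ContinuousLinearMap.proj (R := ℝ) (φ := fun _ : Fin m => ℂ) k).hasFDerivAt.fderiv

theorem fderiv_star_coord (k : Fin m) (α w : Fin m → ℂ) :
    fderiv ℝ (fun β : Fin m → ℂ => star (β k)) α w = star (w k) :=
  congrArg (· w) ((Complex.conjCLE : ℂ →L[ℝ] ℂ).comp
    (ContinuousLinearMap.proj (R := ℝ) (φ := fun _ : Fin m => ℂ) k)).hasFDerivAt.fderiv

theorem alBracket_coord_coord (k l : Fin m) :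
    alBracket (fun α : Fin m → ℂ => α k) (fun α => α l) = fun _ => 0 := by
  funext α
  refine Finset.sum_eq_zero fun j _ => ?_
  simp only [partialU, partialV, fderiv_coord, Pi.single_apply]
  split_ifs <;> simp

theorem alBracket_coord_star_coord (k l : Fin m) :
    alBracket (fun α : Fin m → ℂ => α k) (fun α => star (α l)) =
      fun α => -2 * Complex.I * (if k = l then 1 else 0) * ((rho (α k) ^ 2 : ℝ) : ℂ) := by
  funext α
  rw [alBracket, Fintype.sum_eq_single k]
  · simp only [partialU, partialV, fderiv_coord, fderiv_star_coord, Pi.single_apply, eq_comm]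
    split_ifs <;> simp
    ring
  · intro j hj
    simp [partialU, partialV, fderiv_coord, hj.symm]

end Conclusion

end CMV

end

theorem theoremT (m : ℕ) (a : ℂ) (ha : ‖a‖ = 1) :
    (∀ k l : Fin m,
      CMV.HasGDBracket a (fun α => α k) (fun α => α l) (fun _ => 0) ∧
      CMV.HasGDBracket a (fun α => α k) (fun α => star (α l))
        (fun α => -2 * Complex.I * (if k = l then 1 else 0) * ((CMV.rho (α k) ^ 2 : ℝ) : ℂ))) ∧
    (∀ f g : (Fin m → ℂ) → ℂ,
      ContDiffOn ℝ (⊤ : ℕ∞) f (CMV.polydisc m) → ContDiffOn ℝ (⊤ : ℕ∞) g (CMV.polydisc m) →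
      CMV.HasGDBracket a f g (CMV.alBracket f g)) := by
  have hcoord : ∀ k : Fin m, ContDiff ℝ (⊤ : ℕ∞) fun α : Fin m → ℂ => α k := contDiff_apply ℝ ℂ
  refine ⟨fun k l => ⟨?_, ?_⟩, fun f g hf hg => CMV.hasGDBracket_alBracket ha hf hg⟩
  · rw [← CMV.alBracket_coord_coord k l]
    exact CMV.hasGDBracket_alBracket ha (hcoord k).contDiffOn (hcoord l).contDiffOn
  · rw [← CMV.alBracket_coord_star_coord k l]
    exact CMV.hasGDBracket_alBracket ha (hcoord k).contDiffOn
      (Complex.conjCLE.contDiff.comp (hcoord l)).contDiffOn
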